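/- All rings are unital. For a ring $A$ and a set $\Sigma$ of morphisms between finitely generated projective right $A$-modules, $\ell_\Sigma : A \to A_\Sigma$ denotes the universal localisation: $\sigma\otimes_A A_\Sigma$ is an isomorphism for every $\sigma\in\Sigma$, and every ring homomorphism $A\to C$ with this property factors uniquely through $\ell_\Sigma$. Let $k$ be a commutative ring and $n\in\mathbb N$. The functor $\sqrt[n]{-}$ on $k$-algebras is the left adjoint of the matrix functor $M_n(-)$, with unit $\mu_{A}: A\to M_n(\sqrt[n]{A})$. **Theorem.** Let $f : A\to A'$ be a homomorphism of $k$-algebras, $\Sigma$ a set of morphisms between finitely generated projective right $A$-modules, and suppose that there is a ring isomorphism $e : A_\Sigma\cong M_n(B)$ for some ring $B$. Put $$\Sigma'=\{\sigma\otimes_A A'\},\qquad \Sigma_n=\{\sigma\otimes_A M_n(\sqrt[n]{A})\},\qquad \Sigma'_n=\{\sigma\otimes_A M_n(\sqrt[n]{A'})\}\qquad(\sigma\in\Sigma),$$ the last family being induced along $\mu_{A'} f : A\to A'\to M_n(\sqrt[n]{A'})$. Then: 1. There is a unique ring homomorphism $j : M_n(\sqrt[n]{A})_{\Sigma_n}\to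 M_n(\sqrt[n]{A'})_{\Sigma'_n}$ with $j\,\ell_{\Sigma_n}=\ell_{\Sigma'_n} M_n(\sqrt[n]{f})$. 2. There is a unique ring homomorphism $\pi : M_n(\sqrt[n]{A})_{\Sigma_n}\to A_\Sigma$ such that $\pi\,\ell_{\Sigma_n}\mu_{A}=\ell_\Sigma$ and $e\,\pi\,\ell_{\Sigma_n}$ maps the standard matrix units of $M_n(\sqrt[n]{A})$ to those of $M_n(B)$. 3. Let $\pi : M_n(\sqrt[n]{A})_{\Sigma_n}\to A_\Sigma$ be any ring homomorphism with $\pi\,\ell_{\Sigma_n}\mu_{A}=\ell_\Sigma$ (for instance the one in 2). Then $\pi$ is surjective, so that $A_\Sigma\cong M_n(\sqrt[n]{A})_{\Sigma_n}/I$ with $I=\ker\pi$. Moreover, if $I'$ is the two-sided ideal of $M_n(\sqrt[n]{A'})_{\Sigma'_n}$ generated by $j(I)$, there is a ring isomorphism $$M_n(\sqrt[n]{A'})_{\Sigma'_n}/I'\;\cong\;A'_{\Sigma'}$$ under which the composite $A'\xrightarrow{\mu_{A'}}M_n(\sqrt[n]{A'})\xrightarrow{\ell_{\Sigma'_n}}M_n(\sqrt[n]{A'})_{\Sigma'_n}\to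 M_n(\sqrt[n]{A'})_{\Sigma'_n}/I'$ corresponds to $\ell_{\Sigma'}$. -/

import Mathlib

open scoped TensorProduct RightActions

noncomputable section

/-! Right modules over a ring `A` are modules over `Aᵐᵒᵖ`; `p <• a` is the right action. -/

universe u v w u' k₀

/-! ### Induced right modules -/

section Induced

variable {A : Type u} {B : Type u'} [Ring A] [Ring B] (f : A →+* B)
variable (P : Type v) [AddCommGroup P] [Module Aᵐᵒᵖ P]

/-- The relations `(p a) ⊗ b = p ⊗ (f(a) b)` that turn `P ⊗_ℤ B` into `P ⊗_A B`. The tensor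
`p ⊗ b` is written with the factors exchanged, as `b ⊗ₜ p`, and the right action of `B` is
`(p ⊗ b) b' = p ⊗ (b b')`. -/
def inducedRelations : Submodule Bᵐᵒᵖ (B ⊗[ℤ] P) :=
  Submodule.span Bᵐᵒᵖ
    {x | ∃ (p : P) (a : A) (b : B), x = b ⊗ₜ[ℤ] (p <• a) - (f a * b) ⊗ₜ[ℤ] p}

/-- The induced right `B`-module `P ⊗_A B` of a right `A`-module `P` along `f : A → B`. -/
abbrev InducedModule : Type (max u' v) := (B ⊗[ℤ] P) ⧸ inducedRelations f P

variable {P}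

/-- The element `p ⊗ b` of `P ⊗_A B`. -/
def inducedTensor (p : P) (b : B) : InducedModule f P :=
  (inducedRelations f P).mkQ (b ⊗ₜ[ℤ] p)

lemma inducedTensor_smul (p : P) (a : A) (b : B) :
    inducedTensor f (p <• a) b = inducedTensor f p (f a * b) := by
  unfold inducedTensor
  rw [← sub_eq_zero, ← map_sub]
  exact (Submodule.Quotient.mk_eq_zero _).2 (Submodule.subset_span ⟨p, a, b, rfl⟩)

lemma inducedTensor_act (p : P) (b b' : B) :
    (inducedTensor f p b) <• b' = inducedTensor f p (b * b') := by
  unfold inducedTensor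
  rw [← map_smul]
  rfl

lemma inducedTensor_add_left (p p' : P) (b : B) :
    inducedTensor f (p + p') b = inducedTensor f p b + inducedTensor f p' b := by
  simp only [inducedTensor, TensorProduct.tmul_add, map_add]

lemma inducedTensor_add_right (p : P) (b b' : B) :
    inducedTensor f p (b + b') = inducedTensor f p b + inducedTensor f p b' := by
  simp only [inducedTensor, TensorProduct.add_tmul, map_add]

lemma inducedTensor_sum_left {κ : Type*} (s : Finset κ) (p : κ → P) (b : B) :
    inducedTensor f (∑ j ∈ s, p j) b = ∑ j ∈ s, inducedTensor f (p j) b := by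
  simp only [inducedTensor, TensorProduct.tmul_sum, map_sum]

lemma inducedTensor_sum_right {κ : Type*} (s : Finset κ) (p : P) (b : κ → B) :
    inducedTensor f p (∑ j ∈ s, b j) = ∑ j ∈ s, inducedTensor f p (b j) := by
  simp only [inducedTensor, TensorProduct.sum_tmul, map_sum]

lemma induced_hom_ext {N : Type*} [AddCommGroup N] [Module Bᵐᵒᵖ N]
    {g h : InducedModule f P →ₗ[Bᵐᵒᵖ] N}
    (H : ∀ p, g (inducedTensor f p 1) = h (inducedTensor f p 1)) : g = h := by
  apply Submodule.linearMap_qext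
  apply TensorProduct.AlgebraTensorModule.ext
  intro b p
  have e : (inducedRelations f P).mkQ (b ⊗ₜ[ℤ] p) = (inducedTensor f p 1) <• b := by
    rw [inducedTensor_act, one_mul]; rfl
  simp only [LinearMap.comp_apply]
  rw [e, map_smul, map_smul, H]

/-- A right `A`-linear map `P → N` into a right `B`-module (with `A` acting through `f`) extends
to `P ⊗_A B → N`, `p ⊗ b ↦ g(p) b`. -/
def inducedLift {N : Type*} [AddCommGroup N] [Module Bᵐᵒᵖ N] (g : P →+ N)
    (hg : ∀ p (a : A), g (p <• a) = (g p) <• (f a)) : InducedModule f P →ₗ[Bᵐᵒᵖ] N :=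
  Submodule.liftQ _
    (TensorProduct.AlgebraTensorModule.lift
      { toFun := fun b =>
          (AddMonoidHom.toIntLinearMap
            { toFun := fun p => (g p) <• b
              map_zero' := by simp
              map_add' := fun p q => by simp })
        map_add' := fun b b' => by
          ext p; simp [add_smul]
        map_smul' := fun c b => by
          ext p; simp [mul_smul] })
    (by
      rw [inducedRelations, Submodule.span_le]
      rintro x ⟨p, a, b, rfl⟩
      simp [hg, mul_smul])

@[simp] lemma inducedLift_tensor {N : Type*} [AddCommGroup N] [Module Bᵐᵒᵖ N] (g : P →+ N)
    (hg : ∀ p (a : A), g (p <• a) = (g p) <• (f a)) (p : P) (b : B) :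
    inducedLift f g hg (inducedTensor f p b) = (g p) <• b := rfl

variable {Q : Type v} [AddCommGroup Q] [Module Aᵐᵒᵖ Q]

/-- The induced map `σ ⊗_A B : P ⊗_A B → Q ⊗_A B`, `p ⊗ b ↦ σ(p) ⊗ b`. -/
def inducedMap (σ : P →ₗ[Aᵐᵒᵖ] Q) : InducedModule f P →ₗ[Bᵐᵒᵖ] InducedModule f Q :=
  inducedLift f
    { toFun := fun p => inducedTensor f (σ p) 1
      map_zero' := by simp [inducedTensor]
      map_add' := fun p q => by rw [map_add, inducedTensor_add_left] }
    (fun p a => by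
      simp only [AddMonoidHom.coe_mk, ZeroHom.coe_mk]
      rw [map_smul, inducedTensor_smul, inducedTensor_act, one_mul, mul_one])

@[simp] lemma inducedMap_tensor (σ : P →ₗ[Aᵐᵒᵖ] Q) (p : P) (b : B) :
    inducedMap f σ (inducedTensor f p b) = inducedTensor f (σ p) b := by
  simp only [inducedMap, inducedLift_tensor, AddMonoidHom.coe_mk, ZeroHom.coe_mk]
  rw [inducedTensor_act, one_mul]

/-- The map `P ⊗_A B → B`, `p ⊗ b ↦ f(φ(p)) b`, of a functional `φ : P → A`. -/
def inducedEval (φ : P →ₗ[Aᵐᵒᵖ] A) : InducedModule f P →ₗ[Bᵐᵒᵖ] B :=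
  inducedLift f (f.toAddMonoidHom.comp φ.toAddMonoidHom) (fun p a => by simp)

@[simp] lemma inducedEval_tensor (φ : P →ₗ[Aᵐᵒᵖ] A) (p : P) (b : B) :
    inducedEval f φ (inducedTensor f p b) = f (φ p) * b := rfl

/-- A finitely generated projective right module has a finite dual basis. -/
lemma exists_dualBasis (P : Type v) [AddCommGroup P] [Module Aᵐᵒᵖ P] [Module.Finite Aᵐᵒᵖ P]
    [Module.Projective Aᵐᵒᵖ P] :
    ∃ (m : ℕ) (b : Fin m → P) (φ : Fin m → P →ₗ[Aᵐᵒᵖ] A), ∀ p, ∑ j, (b j) <• (φ j p) = p := by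
  obtain ⟨m, s, t, -, -, hst⟩ := Module.Finite.exists_comp_eq_id_of_projective Aᵐᵒᵖ P
  refine ⟨m, fun j => s (Pi.single j 1), fun j =>
    { toFun := fun p => (t p j).unop
      map_add' := fun p q => by simp
      map_smul' := fun a p => by simp [MulOpposite.smul_eq_mul_unop] }, fun p => ?_⟩
  have h := LinearMap.congr_fun hst p
  simp only [LinearMap.comp_apply, LinearMap.id_apply] at h
  simp only [LinearMap.coe_mk, AddHom.coe_mk, MulOpposite.op_unop]
  have hx : t p = ∑ j, (t p j) • (Pi.single j 1 : Fin m → Aᵐᵒᵖ) := by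
    ext i
    simp [Finset.sum_apply, Pi.single_apply]
  conv_rhs => rw [← h, hx, map_sum]
  simp only [map_smul]

lemma induced_dualBasis {m : ℕ} {b : Fin m → P} {φ : Fin m → P →ₗ[Aᵐᵒᵖ] A}
    (h : ∀ p, ∑ j, (b j) <• (φ j p) = p) (x : InducedModule f P) :
    ∑ j, (inducedTensor f (b j) 1) <• (inducedEval f (φ j) x) = x := by
  let T : InducedModule f P →ₗ[Bᵐᵒᵖ] InducedModule f P :=
    { toFun := fun x => ∑ j, (inducedTensor f (b j) 1) <• (inducedEval f (φ j) x)
      map_add' := fun x y => by simp [add_smul, Finset.sum_add_distrib]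
      map_smul' := fun c x => by
        simp only [map_smul, Finset.smul_sum, RingHom.id_apply, ← mul_smul]
        rfl }
  have : T = LinearMap.id := induced_hom_ext f fun p => by
    change ∑ j : Fin m, (inducedTensor f (b j) 1) <• (inducedEval f (φ j) _) = _
    simp only [inducedEval_tensor, mul_one, LinearMap.id_apply]
    conv_rhs => rw [← h p, inducedTensor_sum_left]
    refine Finset.sum_congr rfl fun j _ => ?_
    rw [inducedTensor_smul, inducedTensor_act, one_mul, mul_one]
  exact LinearMap.congr_fun this x

instance induced_finite [Module.Finite Aᵐᵒᵖ P] [Module.Projective Aᵐᵒᵖ P] :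
    Module.Finite Bᵐᵒᵖ (InducedModule f P) := by
  obtain ⟨m, b, φ, h⟩ := exists_dualBasis (A := A) P
  refine ⟨?_⟩
  have : Submodule.span Bᵐᵒᵖ (Set.range fun j => inducedTensor f (b j) 1) = ⊤ := ?_
  · rw [← this]
    exact Submodule.fg_span (Set.finite_range _)
  rw [eq_top_iff]
  rintro x -
  rw [← induced_dualBasis f h x]
  exact Submodule.sum_mem _ fun j _ => Submodule.smul_mem _ _ (Submodule.subset_span ⟨j, rfl⟩)

instance induced_projective [Module.Finite Aᵐᵒᵖ P] [Module.Projective Aᵐᵒᵖ P] :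
    Module.Projective Bᵐᵒᵖ (InducedModule f P) := by
  obtain ⟨m, b, φ, h⟩ := exists_dualBasis (A := A) P
  refine Module.Projective.of_split (M := Fin m → Bᵐᵒᵖ)
    (LinearMap.pi fun j =>
      { toFun := fun x => MulOpposite.op (inducedEval f (φ j) x)
        map_add' := fun x y => by simp
        map_smul' := fun c x => by simp [MulOpposite.smul_eq_mul_unop] })
    (Fintype.linearCombination Bᵐᵒᵖ fun j => inducedTensor f (b j) 1) ?_
  refine LinearMap.ext fun x => ?_
  simpa [Fintype.linearCombination_apply] using induced_dualBasis f h x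

end Induced

/-! ### Universal localisation -/

/-- A morphism `P → Q` between finitely generated projective right `A`-modules. A set `Σ` of such
morphisms is given as a family `ι → ProjHom A`. -/
structure ProjHom (A : Type u) [Ring A] where
  P : Type v
  Q : Type v
  [addP : AddCommGroup P]
  [addQ : AddCommGroup Q]
  [modP : Module Aᵐᵒᵖ P]
  [modQ : Module Aᵐᵒᵖ Q]
  [finP : Module.Finite Aᵐᵒᵖ P]
  [finQ : Module.Finite Aᵐᵒᵖ Q]
  [projP : Module.Projective Aᵐᵒᵖ P]
  [projQ : Module.Projective Aᵐᵒᵖ Q]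
  hom : P →ₗ[Aᵐᵒᵖ] Q

attribute [instance] ProjHom.addP ProjHom.addQ ProjHom.modP ProjHom.modQ ProjHom.finP ProjHom.finQ
  ProjHom.projP ProjHom.projQ

section Localisation

variable {A : Type u} {B : Type u'} [Ring A] [Ring B] {ι : Type w}

/-- The set `{σ ⊗_A B | σ ∈ Σ}` of induced morphisms along `f : A → B`. -/
def inducedFamily (f : A →+* B) (S : ι → ProjHom.{u, v} A) : ι → ProjHom.{u', max u' v} B :=
  fun i => { P := InducedModule f (S i).P
             Q := InducedModule f (S i).Q
             hom := inducedMap f (S i).hom }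

/-- `f : A → B` is `Σ`-inverting: every `σ ⊗_A B`, `σ ∈ Σ`, is an isomorphism. -/
def IsInverting (S : ι → ProjHom.{u, v} A) (f : A →+* B) : Prop :=
  ∀ i, Function.Bijective (inducedMap f (S i).hom)

variable (S : ι → ProjHom.{u, v} A)

/-- Generators of `A_Σ` as a ring: the elements of `A` and, for `σ : P → Q` in `Σ`, `q ∈ Q` and a
functional `φ : P → A`, a symbol standing for the value of `φ` at `σ⁻¹(q)`. -/
abbrev LocGenerator : Type (max u v w) := A ⊕ (Σ i : ι, ((S i).P →ₗ[Aᵐᵒᵖ] A) × (S i).Q)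

/-- The generator of `A_Σ` given by `a ∈ A`. -/
def locCoe (a : A) : FreeAlgebra ℤ (LocGenerator S) := FreeAlgebra.ι ℤ (Sum.inl a)

/-- The generator of `A_Σ` standing for `φ(σ⁻¹(q))`. -/
def locInv (i : ι) (φ : (S i).P →ₗ[Aᵐᵒᵖ] A) (q : (S i).Q) : FreeAlgebra ℤ (LocGenerator S) :=
  FreeAlgebra.ι ℤ (Sum.inr ⟨i, φ, q⟩)

/-- Defining relations of `A_Σ`: those of the ring `A`, the biadditivity and `A`-bilinearity of
`φ(σ⁻¹(q))`, and `φ(σ⁻¹(σ(p))) = φ(p)`, `ψ(σ(σ⁻¹(q))) = ψ(q)`. -/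
inductive LocRel : FreeAlgebra ℤ (LocGenerator S) → FreeAlgebra ℤ (LocGenerator S) → Prop
  | one : LocRel (locCoe S 1) 1
  | add (a b : A) : LocRel (locCoe S (a + b)) (locCoe S a + locCoe S b)
  | mul (a b : A) : LocRel (locCoe S (a * b)) (locCoe S a * locCoe S b)
  | inv_add_left (i : ι) (φ φ' : (S i).P →ₗ[Aᵐᵒᵖ] A) (q : (S i).Q) :
      LocRel (locInv S i (φ + φ') q) (locInv S i φ q + locInv S i φ' q)
  | inv_add_right (i : ι) (φ : (S i).P →ₗ[Aᵐᵒᵖ] A) (q q' : (S i).Q) :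
      LocRel (locInv S i φ (q + q')) (locInv S i φ q + locInv S i φ q')
  | inv_smul_left (i : ι) (a : A) (φ : (S i).P →ₗ[Aᵐᵒᵖ] A) (q : (S i).Q) :
      LocRel (locInv S i (a • φ) q) (locCoe S a * locInv S i φ q)
  | inv_smul_right (i : ι) (φ : (S i).P →ₗ[Aᵐᵒᵖ] A) (q : (S i).Q) (a : A) :
      LocRel (locInv S i φ (q <• a)) (locInv S i φ q * locCoe S a)
  | inv_hom (i : ι) (φ : (S i).P →ₗ[Aᵐᵒᵖ] A) (p : (S i).P) :
      LocRel (locInv S i φ ((S i).hom p)) (locCoe S (φ p))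
  | hom_inv (i : ι) (ψ : (S i).Q →ₗ[Aᵐᵒᵖ] A) (q : (S i).Q) :
      LocRel (locInv S i (ψ ∘ₗ (S i).hom) q) (locCoe S (ψ q))

/-- The universal localisation `A_Σ` of `A` at `Σ`, by generators and relations. Its
characterisation is in `isInverting_of` and `existsUnique_lift`. -/
def UnivLoc : Type (max u v w) := RingQuot (LocRel S)

instance : Ring (UnivLoc S) := inferInstanceAs (Ring (RingQuot (LocRel S)))

namespace UnivLoc

/-- The class in `A_Σ` of a noncommutative polynomial in the generators. -/
def mk : FreeAlgebra ℤ (LocGenerator S) →+* UnivLoc S := RingQuot.mkRingHom (LocRel S)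

lemma mk_rel {x y : FreeAlgebra ℤ (LocGenerator S)} (h : LocRel S x y) : mk S x = mk S y :=
  RingQuot.mkRingHom_rel h

/-- The universal localisation map `ℓ_Σ : A → A_Σ`. -/
def of : A →+* UnivLoc S :=
  RingHom.mk'
    { toFun := fun a : A => mk S (locCoe S a)
      map_one' := by rw [mk_rel S .one, map_one]
      map_mul' := fun a b => by rw [mk_rel S (.mul a b), map_mul] }
    (fun a b => by
      change mk S (locCoe S (a + b)) = mk S (locCoe S a) + mk S (locCoe S b)
      rw [mk_rel S (.add a b), map_add])

/-- The element of `A_Σ` which is the value of `φ` at `σ⁻¹(q)`. -/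
def inv (i : ι) (φ : (S i).P →ₗ[Aᵐᵒᵖ] A) (q : (S i).Q) : UnivLoc S := mk S (locInv S i φ q)

end UnivLoc

variable {S}

/-- A system of values `y i φ q` of `φ(σ⁻¹(q))` in a ring `B` over `A`. -/
structure IsInvSystem (f : A →+* B) (y : ∀ i, ((S i).P →ₗ[Aᵐᵒᵖ] A) → (S i).Q → B) : Prop where
  add_left : ∀ i φ φ' q, y i (φ + φ') q = y i φ q + y i φ' q
  add_right : ∀ i φ q q', y i φ (q + q') = y i φ q + y i φ q'
  smul_left : ∀ i (a : A) φ q, y i (a • φ) q = f a * y i φ q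
  smul_right : ∀ i φ q (a : A), y i φ (q <• a) = y i φ q * f a
  inv_hom : ∀ i φ p, y i φ ((S i).hom p) = f (φ p)
  hom_inv : ∀ i (ψ : (S i).Q →ₗ[Aᵐᵒᵖ] A) q, y i (ψ ∘ₗ (S i).hom) q = f (ψ q)

lemma IsInvSystem.sum_left {f : A →+* B} {y : ∀ i, ((S i).P →ₗ[Aᵐᵒᵖ] A) → (S i).Q → B}
    (h : IsInvSystem f y) (i : ι) {m : ℕ} (φ : Fin m → (S i).P →ₗ[Aᵐᵒᵖ] A) (q : (S i).Q) :
    y i (∑ j, φ j) q = ∑ j, y i (φ j) q :=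
  map_sum (AddMonoidHom.mk' (fun φ => y i φ q) fun φ φ' => h.add_left i φ φ' q) φ Finset.univ

/-- `q ↦ ∑ p_j ⊗ y(φ_j, q)` is a right inverse of `σ ⊗ B` for a dual basis `(p_j, φ_j)`. -/
lemma IsInvSystem.right_inv {f : A →+* B} {y : ∀ i, ((S i).P →ₗ[Aᵐᵒᵖ] A) → (S i).Q → B}
    (h : IsInvSystem f y) (i : ι) {m : ℕ} {b : Fin m → (S i).P}
    {φ : Fin m → (S i).P →ₗ[Aᵐᵒᵖ] A} (hb : ∀ p, ∑ j, (b j) <• (φ j p) = p) (q : (S i).Q) :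
    inducedMap f (S i).hom (∑ j, inducedTensor f (b j) (y i (φ j) q)) = inducedTensor f q 1 := by
  obtain ⟨r, c, ψ, hc⟩ := exists_dualBasis (A := A) (S i).Q
  rw [← induced_dualBasis f hc (inducedMap f _ _), ← induced_dualBasis f hc (inducedTensor f q 1)]
  refine Finset.sum_congr rfl fun l _ => ?_
  congr 2
  simp only [map_sum, inducedMap_tensor, inducedEval_tensor, mul_one]
  rw [← h.hom_inv]
  have : ψ l ∘ₗ (S i).hom = ∑ j, (ψ l ((S i).hom (b j))) • φ j := by
    ext p
    conv_lhs => rw [← hb p]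
    simp
  rw [this, h.sum_left]
  simp only [h.smul_left]

lemma IsInvSystem.isInverting {f : A →+* B} {y : ∀ i, ((S i).P →ₗ[Aᵐᵒᵖ] A) → (S i).Q → B}
    (h : IsInvSystem f y) : IsInverting S f := by
  intro i
  obtain ⟨m, b, φ, hb⟩ := exists_dualBasis (A := A) (S i).P
  let T : InducedModule f (S i).Q →ₗ[Bᵐᵒᵖ] InducedModule f (S i).P :=
    inducedLift f
      (AddMonoidHom.mk' (fun q => ∑ j, inducedTensor f (b j) (y i (φ j) q)) fun q q' => by
        simp only [h.add_right, inducedTensor_add_right, Finset.sum_add_distrib])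
      (fun q a => by
        simp only [AddMonoidHom.mk'_apply, h.smul_right, Finset.smul_sum, inducedTensor_act])
  have hT : ∀ q, T (inducedTensor f q 1) = ∑ j, inducedTensor f (b j) (y i (φ j) q) := fun q => by
    simp [T]
  have h₁ : T ∘ₗ inducedMap f (S i).hom = LinearMap.id := induced_hom_ext f fun p => by
    rw [LinearMap.comp_apply, inducedMap_tensor, hT, LinearMap.id_apply]
    conv_rhs => rw [← hb p, inducedTensor_sum_left]
    refine Finset.sum_congr rfl fun j _ => ?_
    rw [h.inv_hom, inducedTensor_smul, mul_one]
  have h₂ : inducedMap f (S i).hom ∘ₗ T = LinearMap.id := induced_hom_ext f fun q => by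
    rw [LinearMap.comp_apply, hT, h.right_inv i hb, LinearMap.id_apply]
  exact Function.bijective_iff_has_inverse.2
    ⟨T, LinearMap.congr_fun h₁, LinearMap.congr_fun h₂⟩

lemma IsInvSystem.unique {f : A →+* B} {y z : ∀ i, ((S i).P →ₗ[Aᵐᵒᵖ] A) → (S i).Q → B}
    (hy : IsInvSystem f y) (hz : IsInvSystem f z) : y = z := by
  funext i φ₀ q
  obtain ⟨m, b, φ, hb⟩ := exists_dualBasis (A := A) (S i).P
  have key := (hy.isInverting i).1
    ((hy.right_inv i hb q).trans (hz.right_inv i hb q).symm)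
  have expand : φ₀ = ∑ j, (φ₀ (b j)) • φ j := by
    ext p
    conv_lhs => rw [← hb p]
    simp
  have := congrArg (inducedEval f φ₀) key
  simp only [map_sum, inducedEval_tensor] at this
  rw [expand, hy.sum_left, hz.sum_left]
  simpa only [hy.smul_left, hz.smul_left] using this

lemma IsInverting.exists_invSystem {f : A →+* B} (h : IsInverting S f) :
    ∃ y, IsInvSystem (S := S) f y := by
  let T : ∀ i, InducedModule f (S i).Q ≃ₗ[Bᵐᵒᵖ] InducedModule f (S i).P :=
    fun i => (LinearEquiv.ofBijective _ (h i)).symm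
  have hT₁ : ∀ i x, T i (inducedMap f (S i).hom x) = x := fun i x =>
    (LinearEquiv.ofBijective _ (h i)).symm_apply_apply x
  have hT₂ : ∀ i x, inducedMap f (S i).hom (T i x) = x := fun i x =>
    (LinearEquiv.ofBijective _ (h i)).apply_symm_apply x
  have smulEval : ∀ i (a : A) (φ : (S i).P →ₗ[Aᵐᵒᵖ] A) (x : InducedModule f (S i).P),
      inducedEval f (a • φ) x = f a * inducedEval f φ x := fun i a φ x => by
    have : inducedEval f (a • φ) = f a • inducedEval f φ :=
      induced_hom_ext f fun p => by simp
    rw [this]; rfl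
  refine ⟨fun i φ q => inducedEval f φ (T i (inducedTensor f q 1)), ?_, ?_, ?_, ?_, ?_, ?_⟩
  · intro i φ φ' q
    have : inducedEval f (φ + φ') = inducedEval f φ + inducedEval f φ' :=
      induced_hom_ext f fun p => by simp
    rw [this]; rfl
  · intro i φ q q'
    simp only [inducedTensor_add_left, map_add]
  · intro i a φ q
    exact smulEval i a φ _
  · intro i φ q a
    have : inducedTensor f (q <• a) 1 = (inducedTensor f q 1) <• (f a) := by
      rw [inducedTensor_smul, inducedTensor_act, one_mul, mul_one]
    simp only [this, map_smul]
    rfl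
  · intro i φ p
    simp only [← inducedMap_tensor, hT₁, inducedEval_tensor, mul_one]
  · intro i ψ q
    have : inducedEval f (ψ ∘ₗ (S i).hom) = inducedEval f ψ ∘ₗ inducedMap f (S i).hom :=
      induced_hom_ext f fun p => by simp
    simp only [this, LinearMap.comp_apply, hT₂, inducedEval_tensor, mul_one]

namespace UnivLoc

lemma isInvSystem : IsInvSystem (of S) (inv S) where
  add_left i φ φ' q := by
    unfold inv; rw [mk_rel S (.inv_add_left i φ φ' q), map_add]
  add_right i φ q q' := by
    unfold inv; rw [mk_rel S (.inv_add_right i φ q q'), map_add]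
  smul_left i a φ q := by
    unfold inv; rw [mk_rel S (.inv_smul_left i a φ q), map_mul]; rfl
  smul_right i φ q a := by
    unfold inv; rw [mk_rel S (.inv_smul_right i φ q a), map_mul]; rfl
  inv_hom i φ p := by
    unfold inv; rw [mk_rel S (.inv_hom i φ p)]; rfl
  hom_inv i ψ q := by
    unfold inv; rw [mk_rel S (.hom_inv i ψ q)]; rfl

variable (S) in
/-- `ℓ_Σ` is `Σ`-inverting. -/
theorem isInverting_of : IsInverting S (of S) := isInvSystem.isInverting

/-- `ℓ_Σ` is universal among the `Σ`-inverting ring homomorphisms. -/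
theorem existsUnique_lift (f : A →+* B) (hf : IsInverting S f) :
    ∃! g : UnivLoc S →+* B, g.comp (of S) = f := by
  obtain ⟨y, hy⟩ := hf.exists_invSystem
  let F : FreeAlgebra ℤ (LocGenerator S) →ₐ[ℤ] B :=
    FreeAlgebra.lift ℤ (Sum.elim f fun x => y x.1 x.2.1 x.2.2)
  have F₁ : ∀ a, F (locCoe S a) = f a := fun a => by simp [F, locCoe]
  have F₂ : ∀ i φ q, F (locInv S i φ q) = y i φ q := fun i φ q => by simp [F, locInv]
  have hF : ∀ ⦃a b⦄, LocRel S a b → (F : _ →+* B) a = (F : _ →+* B) b := by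
    intro a b hab
    cases hab <;>
      simp [F₁, F₂, hy.add_left, hy.add_right, hy.smul_left, hy.smul_right, hy.inv_hom, hy.hom_inv]
  refine ⟨RingQuot.lift ⟨(F : _ →+* B), hF⟩, ?_, ?_⟩
  · refine RingHom.ext fun a => ?_
    exact (RingQuot.lift_mkRingHom_apply (F : FreeAlgebra ℤ (LocGenerator S) →+* B) hF
      (locCoe S a)).trans (F₁ a)
  · intro g hg
    have hga : ∀ a, g (mk S (locCoe S a)) = f a := fun a => RingHom.congr_fun hg a
    have hgs : IsInvSystem f fun i φ q => g (inv S i φ q) := by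
      have hs := isInvSystem (S := S)
      have hga' : ∀ a, g (of S a) = f a := hga
      constructor <;> intros
      · simp only [hs.add_left, map_add]
      · simp only [hs.add_right, map_add]
      · simp only [hs.smul_left, map_mul, hga']
      · simp only [hs.smul_right, map_mul, hga']
      · simp only [hs.inv_hom, hga']
      · simp only [hs.hom_inv, hga']
    have hgy := hgs.unique hy
    refine RingQuot.lift_unique (F : _ →+* B) hF g ?_
    have : (g.comp (mk S)).toIntAlgHom = F := by
      apply FreeAlgebra.hom_ext
      funext x
      rcases x with a | ⟨i, φ, q⟩
      · exact (hga a).trans (F₁ a).symm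
      · exact (congrFun (congrFun (congrFun hgy i) φ) q).trans (F₂ i φ q).symm
    ext x
    exact DFunLike.congr_fun this x

end UnivLoc

end Localisation

/-! ### The matrix reduction functor -/

section MatrixReduction

variable (k : Type k₀) [CommRing k] (n : ℕ) (A : Type u) [Ring A] [Algebra k A]

/-- The generator of `ⁿ√A` that is the `(s, t)` entry of the generic image of `a`. -/
def entryGen (a : A) (s t : Fin n) : FreeAlgebra k (A × Fin n × Fin n) :=
  FreeAlgebra.ι k (a, s, t)

/-- Defining relations of `ⁿ√A`: the matrices of generators depend on `a ∈ A` as a homomorphism of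
`k`-algebras. -/
inductive EntryRel :
    FreeAlgebra k (A × Fin n × Fin n) → FreeAlgebra k (A × Fin n × Fin n) → Prop
  | one (s t : Fin n) : EntryRel (entryGen k n A 1 s t) (if s = t then 1 else 0)
  | add (a b : A) (s t : Fin n) :
      EntryRel (entryGen k n A (a + b) s t) (entryGen k n A a s t + entryGen k n A b s t)
  | smul (c : k) (a : A) (s t : Fin n) :
      EntryRel (entryGen k n A (c • a) s t) (c • entryGen k n A a s t)
  | mul (a b : A) (s t : Fin n) :
      EntryRel (entryGen k n A (a * b) s t)
        (∑ l, entryGen k n A a s l * entryGen k n A b l t)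

/-- The `n`-matrix reduction `ⁿ√A` of a `k`-algebra `A`. -/
def MatrixReduction : Type (max k₀ u) := RingQuot (EntryRel k n A)

instance : Ring (MatrixReduction k n A) := inferInstanceAs (Ring (RingQuot (EntryRel k n A)))

instance : Algebra k (MatrixReduction k n A) :=
  inferInstanceAs (Algebra k (RingQuot (EntryRel k n A)))

namespace MatrixReduction

/-- The class in `ⁿ√A` of a noncommutative polynomial in the generators. -/
def mk : FreeAlgebra k (A × Fin n × Fin n) →ₐ[k] MatrixReduction k n A :=
  RingQuot.mkAlgHom k (EntryRel k n A)

lemma mk_rel {x y : FreeAlgebra k (A × Fin n × Fin n)} (h : EntryRel k n A x y) :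
    mk k n A x = mk k n A y :=
  RingQuot.mkAlgHom_rel k h

/-- The unit `μ_{A,n} : A → M_n(ⁿ√A)`. -/
def unit : A →ₐ[k] Matrix (Fin n) (Fin n) (MatrixReduction k n A) :=
  AlgHom.ofLinearMap
    { toFun := fun a => Matrix.of fun s t => mk k n A (entryGen k n A a s t)
      map_add' := fun a b => by
        ext s t
        simp only [Matrix.of_apply, Matrix.add_apply]
        rw [mk_rel k n A (.add a b s t), map_add]
      map_smul' := fun c a => by
        ext s t
        simp only [Matrix.of_apply, Matrix.smul_apply, RingHom.id_apply]
        rw [mk_rel k n A (.smul c a s t), map_smul] }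
    (by
      ext s t
      simp only [LinearMap.coe_mk, AddHom.coe_mk, Matrix.of_apply, Matrix.one_apply]
      rw [mk_rel k n A (.one s t)]
      split_ifs <;> simp)
    (fun a b => by
      ext s t
      simp only [LinearMap.coe_mk, AddHom.coe_mk, Matrix.of_apply, Matrix.mul_apply]
      rw [mk_rel k n A (.mul a b s t), map_sum]
      simp only [map_mul])

variable {k n A} {C : Type u'} [Ring C] [Algebra k C]

/-- The adjoint `g' : ⁿ√A → C` of a homomorphism of `k`-algebras `g : A → M_n(C)`. -/
def lift (g : A →ₐ[k] Matrix (Fin n) (Fin n) C) : MatrixReduction k n A →ₐ[k] C :=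
  RingQuot.liftAlgHom k ⟨FreeAlgebra.lift k fun x => g x.1 x.2.1 x.2.2, by
    intro x y h
    cases h with
    | one s t => split_ifs <;> simp [entryGen, *]
    | add a b s t => simp [entryGen]
    | smul c a s t => simp [entryGen]
    | mul a b s t => simp [entryGen, Matrix.mul_apply]⟩

lemma lift_unit_apply (g : A →ₐ[k] Matrix (Fin n) (Fin n) C) (a : A) (s t : Fin n) :
    lift g (unit k n A a s t) = g a s t := by
  change lift g (RingQuot.mkAlgHom k _ _) = _
  rw [lift]
  exact (RingQuot.liftAlgHom_mkAlgHom_apply _ _ _ _).trans (by simp [entryGen])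

/-- The universal property of `μ_{A,n}`, i.e. the adjunction between `ⁿ√` and `M_n`. -/
theorem existsUnique_lift (g : A →ₐ[k] Matrix (Fin n) (Fin n) C) :
    ∃! g' : MatrixReduction k n A →ₐ[k] C, g'.mapMatrix.comp (unit k n A) = g := by
  refine ⟨lift g, ?_, fun g' hg' => ?_⟩
  · ext a s t
    exact lift_unit_apply g a s t
  · apply RingQuot.ringQuot_ext'
    apply FreeAlgebra.hom_ext
    funext ⟨a, s, t⟩
    have h₁ : g' (unit k n A a s t) = g a s t := by rw [← hg']; rfl
    exact h₁.trans (lift_unit_apply g a s t).symm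

variable (n) {A' : Type u'} [Ring A'] [Algebra k A']

/-- The functor `ⁿ√` on homomorphisms of `k`-algebras. -/
def map (f : A →ₐ[k] A') : MatrixReduction k n A →ₐ[k] MatrixReduction k n A' :=
  lift ((unit k n A').comp f)

end MatrixReduction

/-- The matrix algebra `M_n(ⁿ√A)`. -/
abbrev MatRed : Type (max k₀ u) := Matrix (Fin n) (Fin n) (MatrixReduction k n A)

variable {k A} in
/-- The homomorphism `M_n(ⁿ√f) : M_n(ⁿ√A) → M_n(ⁿ√A')`. -/
def MatRed.map {A' : Type u'} [Ring A'] [Algebra k A'] (f : A →ₐ[k] A') :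
    MatRed k n A →ₐ[k] MatRed k n A' :=
  (MatrixReduction.map n f).mapMatrix

/-- The set `Σ_n = {σ ⊗_A M_n(ⁿ√A) | σ ∈ Σ}` of maps induced along `μ_{A,n}`. -/
abbrev matFamily {A : Type u} [Ring A] [Algebra k A] {ι : Type w} (S : ι → ProjHom.{u, v} A) :
    ι → ProjHom (MatRed k n A) :=
  inducedFamily (MatrixReduction.unit k n A).toRingHom S

variable {k A} in
/-- The set `Σ'_n = {σ ⊗_A M_n(ⁿ√A') | σ ∈ Σ}` of maps induced along the composite
`A → A' → M_n(ⁿ√A')`. -/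
abbrev matFamilyAlong {A' : Type u'} [Ring A'] [Algebra k A'] (f : A →ₐ[k] A') {ι : Type w}
    (S : ι → ProjHom.{u, v} A) : ι → ProjHom (MatRed k n A') :=
  inducedFamily ((MatrixReduction.unit k n A').comp f).toRingHom S

end MatrixReduction

end

/-!
Write `L = M_n(ⁿ√A)_{Σ_n}`, `L' = M_n(ⁿ√A')_{Σ'_n}`, and `I'` for the ideal of `L'` generated by
`j(ker π)`. The proof compares ring homomorphisms by universal properties only.

A homomorphism out of `M_n(ⁿ√A)` is the same thing as a homomorphism `h : A → T` under which `k`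
becomes central, together with a system of `n × n` matrix units of `T`: the entries of `h a` with
respect to the matrix units lie in their centralizer `C`, and `A → M_n(C)` corresponds to
`ⁿ√A → C` (`MatRed.exists_ringHom`, `MatRed.ringHom_ext`). It applies to `T = A_Σ` and
`T = A'_{Σ'}`, since elements central in a ring stay central in a universal localisation
(`UnivLoc.commute_of`). As induction of modules is transitive, inverting `σ ⊗_A M_n(ⁿ√A)` over
`M_n(ⁿ√A)` is the same as inverting `σ` over `A` (`isInverting_inducedFamily_iff`), so `j` and `π`
exist, and they are unique because localisations are ring epimorphisms (`UnivLoc.hom_ext`).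

The homomorphism `ℓ_{Σ_n} μ_A` inverts `Σ`, hence induces `θ : A_Σ → L` with `π θ = 1`, and `π` is
surjective (`exists_section`). The images under `A_Σ → A'_{Σ'}` of the matrix units `π(e_st)` and
the map `ℓ_{Σ'}` define `L' → A'_{Σ'}`. Its composite with `j` is `L → A_Σ → A'_{Σ'}`, so it kills
`I'`. Conversely `A' → L'/I'` inverts `Σ'` and induces `A'_{Σ'} → L'/I'`. The two maps are
mutually inverse: on `A'` this is clear, and on matrix units it holds because
`θ π(e_st) - e_st` lies in `ker π`, so that its image under `j` vanishes in `L'/I'`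
(`exists_quotient_equiv`).
-/

noncomputable section

/-! ### Iterated induction -/

section Induction

universe a b c p q

variable {A : Type a} {B : Type b} {C : Type c} [Ring A] [Ring B] [Ring C]
variable (f : A →+* B) (g : B →+* C)
variable {P : Type p} [AddCommGroup P] [Module Aᵐᵒᵖ P]

/-- A right `A`-linear map `P → N` into a right `C`-module (with `A` acting through `g ∘ f`)
extends to `(P ⊗_A B) ⊗_B C → N`, `(p ⊗ b) ⊗ c ↦ φ(p) g(b) c`. The action of `B` on `N` through
`g` is taken as an instance with the law `hN`. -/
def inducedLiftTwice {N : Type*} [AddCommGroup N] [Module Cᵐᵒᵖ N] [Module Bᵐᵒᵖ N]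
    (hN : ∀ (y : N) (b : B), y <• b = y <• g b) (φ : P →+ N)
    (hφ : ∀ p (a : A), φ (p <• a) = φ p <• f a) :
    InducedModule g (InducedModule f P) →ₗ[Cᵐᵒᵖ] N :=
  inducedLift g (inducedLift f φ hφ).toAddMonoidHom
    (fun x b => ((inducedLift f φ hφ).map_smul (.op b) x).trans (hN _ b))

variable (P)

/-- The canonical map `(P ⊗_A B) ⊗_B C → P ⊗_A C`, `(p ⊗ b) ⊗ c ↦ p ⊗ g(b) c`. -/
def inducedCompHom :
    InducedModule g (InducedModule f P) →ₗ[Cᵐᵒᵖ] InducedModule (g.comp f) P :=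
  letI : Module Bᵐᵒᵖ (InducedModule (g.comp f) P) := Module.compHom _ g.op
  inducedLiftTwice f g (fun _ _ => rfl)
    (AddMonoidHom.mk' (fun p => inducedTensor (g.comp f) p 1)
      fun p p' => inducedTensor_add_left _ p p' 1)
    (fun p a => by
      change inducedTensor (g.comp f) (p <• a) 1 = inducedTensor (g.comp f) p 1 <• g (f a)
      rw [inducedTensor_smul, inducedTensor_act, one_mul, mul_one, RingHom.comp_apply])

variable {P}

@[simp] lemma inducedCompHom_tensor (x : P) (b : B) (c : C) :
    inducedCompHom f g P (inducedTensor g (inducedTensor f x b) c) =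
      inducedTensor (g.comp f) x (g b * c) := by
  change (inducedTensor (g.comp f) x 1 <• g b) <• c = _
  rw [inducedTensor_act, inducedTensor_act, one_mul]

variable (P)

/-- The canonical map `P ⊗_A C → (P ⊗_A B) ⊗_B C`, `p ⊗ c ↦ (p ⊗ 1) ⊗ c`. -/
def inducedCompInv :
    InducedModule (g.comp f) P →ₗ[Cᵐᵒᵖ] InducedModule g (InducedModule f P) :=
  inducedLift (g.comp f)
    (AddMonoidHom.mk' (fun p => inducedTensor g (inducedTensor f p 1) 1) fun p p' => by
      rw [inducedTensor_add_left, inducedTensor_add_left])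
    (fun p a => by
      simp only [AddMonoidHom.mk'_apply, RingHom.comp_apply]
      rw [inducedTensor_act, inducedTensor_smul, mul_one, one_mul, ← one_mul (f a),
        ← inducedTensor_act, inducedTensor_smul, one_mul, mul_one])

variable {P}

@[simp] lemma inducedCompInv_tensor (x : P) (c : C) :
    inducedCompInv f g P (inducedTensor (g.comp f) x c) =
      inducedTensor g (inducedTensor f x 1) c := by
  change inducedTensor g (inducedTensor f x 1) 1 <• c = _
  rw [inducedTensor_act, one_mul]

variable (P)

/-- Induction along `f` and then `g` is induction along `g ∘ f`. -/
def inducedCompEquiv :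
    InducedModule g (InducedModule f P) ≃ₗ[Cᵐᵒᵖ] InducedModule (g.comp f) P :=
  LinearEquiv.ofLinearMap (inducedCompHom f g P) (inducedCompInv f g P)
    (induced_hom_ext _ fun x => by simp)
    (by
      -- it suffices to compare the two maps on `y ⊗ 1`, additively in `y ∈ P ⊗_A B`
      apply induced_hom_ext
      intro y
      rw [← Submodule.Quotient.mk_out y]
      generalize Quotient.out y = z
      change _ = inducedTensor g ((inducedRelations f P).mkQ z) 1
      change inducedCompInv f g P (inducedCompHom f g P
        (inducedTensor g ((inducedRelations f P).mkQ z) 1)) = _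
      induction z with
      | zero => simp [inducedTensor]
      | tmul b x =>
        change inducedCompInv f g P (inducedCompHom f g P
          (inducedTensor g (inducedTensor f x b) 1)) = inducedTensor g (inducedTensor f x b) 1
        rw [inducedCompHom_tensor, inducedCompInv_tensor, ← inducedTensor_smul,
          inducedTensor_act, one_mul]
      | add x y hx hy => rw [map_add, inducedTensor_add_left, map_add, map_add, hx, hy])

variable {P} {Q : Type p} [AddCommGroup Q] [Module Aᵐᵒᵖ Q]

lemma inducedCompInv_inducedMap (σ : P →ₗ[Aᵐᵒᵖ] Q)
    (y : InducedModule (g.comp f) P) :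
    inducedCompInv f g Q (inducedMap (g.comp f) σ y) =
      inducedMap g (inducedMap f σ) (inducedCompInv f g P y) := by
  have : inducedCompInv f g Q ∘ₗ inducedMap (g.comp f) σ =
      inducedMap g (inducedMap f σ) ∘ₗ inducedCompInv f g P :=
    induced_hom_ext _ fun x => by simp
  exact LinearMap.congr_fun this y

lemma isInverting_inducedFamily_iff {ι : Type q} (S : ι → ProjHom.{a, p} A) :
    IsInverting (inducedFamily f S) g ↔ IsInverting S (g.comp f) := by
  refine forall_congr' fun i => ?_
  have h : (inducedCompEquiv f g (S i).Q).symm ∘ inducedMap (g.comp f) (S i).hom =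
      inducedMap g (inducedMap f (S i).hom) ∘ (inducedCompEquiv f g (S i).P).symm :=
    funext (inducedCompInv_inducedMap f g (S i).hom)
  rw [← Function.Bijective.of_comp_iff' (inducedCompEquiv f g (S i).Q).symm.bijective, h]
  exact (Function.Bijective.of_comp_iff _ (inducedCompEquiv f g (S i).P).symm.bijective).symm

lemma IsInverting.comp {ι : Type q} {S : ι → ProjHom.{a, p} A} {f : A →+* B}
    (hf : IsInverting S f) (g : B →+* C) : IsInverting S (g.comp f) := by
  obtain ⟨y, hy⟩ := hf.exists_invSystem
  refine IsInvSystem.isInverting (y := fun i φ q => g (y i φ q)) ?_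
  constructor <;> intros
  · simp only [hy.add_left, map_add]
  · simp only [hy.add_right, map_add]
  · simp only [hy.smul_left, map_mul, RingHom.comp_apply]
  · simp only [hy.smul_right, map_mul, RingHom.comp_apply]
  · simp only [hy.inv_hom, RingHom.comp_apply]
  · simp only [hy.hom_inv, RingHom.comp_apply]

end Induction

/-! ### Universal localisation as a ring epimorphism -/

section Epimorphism

universe a b c p q

variable {A : Type a} {C : Type c} [Ring A] [Ring C] {ι : Type q} {S : ι → ProjHom.{a, p} A}

lemma UnivLoc.hom_ext {g h : UnivLoc S →+* C} (H : g.comp (of S) = h.comp (of S)) : g = h :=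
  (UnivLoc.existsUnique_lift (h.comp (of S)) ((isInverting_of S).comp h)).unique H rfl

/-- Centrality of a scalar passes to the localisation: conjugation of the diagonal embedding
`A_Σ → M₂(A_Σ)` by the elementary matrix with entry `c` fixes the image of `A`, hence
everything. -/
lemma UnivLoc.commute_of {c : A} (hc : ∀ a, Commute c a) (x : UnivLoc S) :
    Commute (of S c) x := by
  let D : UnivLoc S →+* Matrix (Fin 2) (Fin 2) (UnivLoc S) := Matrix.scalar (Fin 2)
  let U : Matrix (Fin 2) (Fin 2) (UnivLoc S) := !![1, of S c; 0, 1]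
  let V : Matrix (Fin 2) (Fin 2) (UnivLoc S) := !![1, -of S c; 0, 1]
  have hUV : U * V = 1 := by simp [U, V, Matrix.one_fin_two]
  have hVU : V * U = 1 := by simp [U, V, Matrix.one_fin_two]
  have hUD : ∀ x, U * D x = !![x, of S c * x; 0, x] := fun x => by
    ext i j; fin_cases i <;> fin_cases j <;> simp [U, D, Matrix.mul_apply, Fin.sum_univ_two]
  have hDU : ∀ x, D x * U = !![x, x * of S c; 0, x] := fun x => by
    ext i j; fin_cases i <;> fin_cases j <;> simp [U, D, Matrix.mul_apply, Fin.sum_univ_two]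
  let K : UnivLoc S →+* Matrix (Fin 2) (Fin 2) (UnivLoc S) :=
    { toFun := fun x => U * D x * V
      map_one' := by rw [map_one, mul_one, hUV]
      map_zero' := by rw [map_zero, mul_zero, zero_mul]
      map_add' := fun x y => by rw [map_add, mul_add, add_mul]
      map_mul' := fun x y => by
        rw [map_mul]
        calc U * (D x * D y) * V = U * D x * (1 : Matrix _ _ _) * D y * V := by
              simp only [mul_assoc, one_mul]
          _ = U * D x * V * (U * D y * V) := by rw [← hVU]; simp only [mul_assoc] }
  have hK : K = D := by
    refine hom_ext (RingHom.ext fun a => ?_)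
    change U * D (of S a) * V = D (of S a)
    have h : U * D (of S a) = D (of S a) * U := by
      rw [hUD, hDU, ← (of S).map_mul, ← (of S).map_mul, (hc a).eq]
    rw [h, mul_assoc, hUV, mul_one]
  have h : U * D x = D x * U := by
    have h1 : U * D x * V = D x := RingHom.congr_fun hK x
    calc U * D x = U * D x * V * U := by rw [mul_assoc _ V U, hVU, mul_one]
      _ = D x * U := by rw [h1]
  rw [hUD, hDU] at h
  exact congrFun (congrFun h 0) 1

end Epimorphism

/-! ### Systems of matrix units -/

section MatrixUnits

variable {m : Type*} [Fintype m] [DecidableEq m] {R T T' : Type*} [Ring R] [Ring T] [Ring T']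

/-- A family `E` is a system of matrix units of the ring `T`, in the unital sense that its diagonal
members sum to `1`. -/
structure IsMatrixUnits (E : m → m → T) : Prop where
  mul : ∀ s t u v, E s t * E u v = if t = u then E s v else 0
  sum : ∑ s, E s s = 1

lemma isMatrixUnits_single : IsMatrixUnits fun s t : m => (Matrix.single s t 1 : Matrix m m R) where
  mul s t u v := by
    split_ifs with h
    · subst h; simp
    · simp [h]
  sum := by
    ext i j
    simp [Matrix.sum_apply, Matrix.single_apply, Matrix.one_apply, ite_and]

lemma IsMatrixUnits.map {E : m → m → T} (hE : IsMatrixUnits E) (g : T →+* T') :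
    IsMatrixUnits fun s t => g (E s t) where
  mul s t u v := by rw [← map_mul, hE.mul]; split_ifs <;> simp
  sum := by rw [← map_sum, hE.sum, map_one]

/-- The `(s, t)` entry of `x : T` with respect to the matrix units `E`. -/
def unitEntry (E : m → m → T) (x : T) (s t : m) : T := ∑ l, E l s * x * E t l

namespace IsMatrixUnits

variable {E : m → m → T} (hE : IsMatrixUnits E)

include hE

lemma unitEntry_one (s t : m) : unitEntry E 1 s t = if s = t then 1 else 0 := by
  simp only [unitEntry, mul_one, hE.mul]
  split_ifs
  · exact hE.sum
  · simp

lemma unitEntry_mul_unit (x : T) (s t u v : m) :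
    unitEntry E x s t * E u v = E u s * x * E t v := by
  simp [unitEntry, Finset.sum_mul, mul_assoc, hE.mul]

lemma unit_mul_unitEntry (x : T) (s t u v : m) :
    E u v * unitEntry E x s t = E u s * x * E t v := by
  simp [unitEntry, Finset.mul_sum, ← mul_assoc, hE.mul]

lemma unitEntry_mul (x y : T) (s t : m) :
    unitEntry E (x * y) s t = ∑ r, unitEntry E x s r * unitEntry E y r t := by
  have h : ∀ r, unitEntry E x s r * unitEntry E y r t =
      ∑ l, E l s * x * E r r * y * E t l := fun r => by
    conv_lhs => rw [unitEntry.eq_def E y, Finset.mul_sum]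
    simp only [← mul_assoc, hE.unitEntry_mul_unit]
  simp only [h]
  rw [Finset.sum_comm]
  refine Finset.sum_congr rfl fun l _ => ?_
  simp only [← Finset.sum_mul, ← Finset.mul_sum, hE.sum, mul_assoc, one_mul]

lemma sum_unitEntry_mul (x : T) : ∑ s, ∑ t, unitEntry E x s t * E s t = x := by
  simp only [hE.unitEntry_mul_unit, ← Finset.mul_sum, ← Finset.sum_mul, hE.sum, one_mul, mul_one]

/-- A ring homomorphism whose values commute with the matrix units `E` extends to matrices, with
the standard matrix units going to `E`. -/
def matrixHom (g : R →+* T) (hg : ∀ r s t, Commute (g r) (E s t)) : Matrix m m R →+* T where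
  toFun M := ∑ s, ∑ t, g (M s t) * E s t
  map_one' := by simp [Matrix.one_apply, apply_ite g, hE.sum]
  map_zero' := by simp
  map_add' M N := by simp [add_mul, Finset.sum_add_distrib]
  map_mul' M N := by
    have h : ∀ s l t u, g (M s l) * E s l * (g (N t u) * E t u) =
        if l = t then g (M s l) * g (N t u) * E s u else 0 := fun s l t u => by
      rw [mul_assoc, ← mul_assoc (E s l), ← (hg (N t u) s l).eq, mul_assoc, hE.mul]
      split_ifs <;> simp [mul_assoc]
    have h' : ∀ s l, g (M s l) * E s l * ∑ t, ∑ u, g (N t u) * E t u =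
        ∑ u, g (M s l) * g (N l u) * E s u := fun s l => by
      simp only [Finset.mul_sum, h]
      rw [Finset.sum_comm]
      simp
    simp only [Finset.sum_mul, h', Matrix.mul_apply, map_sum, map_mul]
    exact Finset.sum_congr rfl fun s _ => Finset.sum_comm

lemma matrixHom_apply (g : R →+* T) (hg : ∀ r s t, Commute (g r) (E s t)) (M : Matrix m m R) :
    hE.matrixHom g hg M = ∑ s, ∑ t, g (M s t) * E s t := rfl

lemma matrixHom_single (g : R →+* T) (hg : ∀ r s t, Commute (g r) (E s t)) (s t : m) :
    hE.matrixHom g hg (Matrix.single s t 1) = E s t := by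
  simp [matrixHom_apply, Matrix.single_apply, apply_ite g, ite_and]

end IsMatrixUnits

lemma Matrix.scalar_entry_eq_sum (M : Matrix m m R) (s t : m) :
    Matrix.scalar m (M s t) = ∑ l, Matrix.single l s 1 * M * Matrix.single t l 1 := by
  ext i j
  simp [Matrix.sum_apply, Matrix.single_mul_mul_single, Matrix.single_apply, Matrix.scalar_apply,
    Matrix.diagonal_apply, ite_and]

lemma Matrix.ringHom_ext_scalar_single {g h : Matrix m m R →+* T}
    (H : ∀ r, g (Matrix.scalar m r) = h (Matrix.scalar m r))
    (H' : ∀ s t, g (Matrix.single s t 1) = h (Matrix.single s t 1)) : g = h := by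
  ext M
  have hM : M = ∑ s, ∑ t, Matrix.scalar m (M s t) * Matrix.single s t 1 := by
    ext i j
    simp [Matrix.sum_apply, Matrix.single_apply, Matrix.scalar_apply, ite_and]
  rw [hM]
  simp only [map_sum, map_mul, H, H']

end MatrixUnits

/-! ### The universal property of `M_n(ⁿ√A)` among rings with matrix units -/

section MatRed

variable {k : Type*} [CommRing k] {n : ℕ} {A : Type*} [Ring A] [Algebra k A] {T : Type*} [Ring T]

/-- `M_n(ⁿ√A)` is generated as a ring by the image of `A` and the standard matrix units. No
`k`-linearity is needed, since `μ_A` carries the image of `k` in `A` to the scalars. -/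
lemma MatRed.ringHom_ext {g h : MatRed k n A →+* T}
    (H : ∀ a, g (MatrixReduction.unit k n A a) = h (MatrixReduction.unit k n A a))
    (H' : ∀ s t, g (Matrix.single s t 1) = h (Matrix.single s t 1)) : g = h := by
  refine Matrix.ringHom_ext_scalar_single (fun r => ?_) H'
  obtain ⟨x, rfl⟩ : ∃ x, MatrixReduction.mk k n A x = r := RingQuot.mkAlgHom_surjective _ _ r
  induction x with
  | grade0 c =>
    have hc : Matrix.scalar (Fin n) (MatrixReduction.mk k n A (algebraMap k _ c)) =
        MatrixReduction.unit k n A (algebraMap k A c) := by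
      rw [AlgHom.commutes, AlgHom.commutes]
      rfl
    rw [hc, H]
  | grade1 x =>
    obtain ⟨a, s, t⟩ := x
    change g (Matrix.scalar (Fin n) (MatrixReduction.unit k n A a s t)) =
      h (Matrix.scalar (Fin n) (MatrixReduction.unit k n A a s t))
    rw [Matrix.scalar_entry_eq_sum]
    simp only [map_sum, map_mul, H, H']
  | mul x y hx hy => simp only [map_mul, hx, hy]
  | add x y hx hy => simp only [map_add, hx, hy]

/-- A homomorphism from `A` to a ring `T` with matrix units extends to `M_n(ⁿ√A)`: the entries
with respect to the matrix units lie in their centralizer `C`, so that `A → T` is a homomorphism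
`A → M_n(C)`. -/
lemma MatRed.exists_ringHom (h : A →+* T) (hc : ∀ (c : k) x, Commute (h (algebraMap k A c)) x)
    {E : Fin n → Fin n → T} (hE : IsMatrixUnits E) :
    ∃ g : MatRed k n A →+* T, (∀ a, g (MatrixReduction.unit k n A a) = h a) ∧
      ∀ s t, g (Matrix.single s t 1) = E s t := by
  let _ : Algebra k T := (h.comp (algebraMap k A)).toAlgebra' hc
  let C : Subalgebra k T := Subalgebra.centralizer k {x | ∃ s t, E s t = x}
  let G : A →ₐ[k] Matrix (Fin n) (Fin n) C := AlgHom.ofLinearMap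
    { toFun := fun a => Matrix.of fun s t => ⟨unitEntry E (h a) s t, by
        rw [Subalgebra.mem_centralizer_iff]
        rintro _ ⟨u, v, rfl⟩
        rw [hE.unit_mul_unitEntry, hE.unitEntry_mul_unit]⟩
      map_add' := fun a b => by
        ext s t
        simp [unitEntry, mul_add, add_mul, Finset.sum_add_distrib]
      map_smul' := fun c a => by
        ext s t
        have hs : ∀ x : T, c • x = h (algebraMap k A c) * x := fun _ => rfl
        simp only [unitEntry, Matrix.of_apply, RingHom.id_apply, Matrix.smul_apply,
          Subalgebra.coe_smul, Finset.smul_sum, Algebra.smul_def c a, map_mul]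
        refine Finset.sum_congr rfl fun l _ => ?_
        rw [hs, ← mul_assoc, ← (hc c _).eq]
        simp only [mul_assoc] }
    (by
      ext s t
      simp only [LinearMap.coe_mk, AddHom.coe_mk, Matrix.of_apply, map_one, hE.unitEntry_one,
        Matrix.one_apply]
      split_ifs <;> rfl)
    (fun a b => by
      ext s t
      simp [Matrix.mul_apply, hE.unitEntry_mul])
  let r : MatrixReduction k n A →+* T := C.val.toRingHom.comp (MatrixReduction.lift G).toRingHom
  have hr : ∀ x s t, Commute (r x) (E s t) := fun x s t =>
    (Subalgebra.mem_centralizer_iff k |>.1 (MatrixReduction.lift G x).2 _ ⟨s, t, rfl⟩).symm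
  refine ⟨hE.matrixHom r hr, fun a => ?_, hE.matrixHom_single r hr⟩
  rw [hE.matrixHom_apply]
  conv_rhs => rw [← hE.sum_unitEntry_mul (h a)]
  refine Finset.sum_congr rfl fun s _ => Finset.sum_congr rfl fun t _ => ?_
  exact congrArg (· * E s t) (congrArg Subtype.val (MatrixReduction.lift_unit_apply G a s t))

lemma MatRed.map_unit {A' : Type*} [Ring A'] [Algebra k A'] (f : A →ₐ[k] A') (a : A) :
    MatRed.map n f (MatrixReduction.unit k n A a) = MatrixReduction.unit k n A' (f a) := by
  ext s t
  exact MatrixReduction.lift_unit_apply _ a s t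

lemma MatRed.map_single {A' : Type*} [Ring A'] [Algebra k A'] (f : A →ₐ[k] A') (s t : Fin n) :
    MatRed.map n f (Matrix.single s t 1) = Matrix.single s t 1 := by
  ext u v
  simp [MatRed.map, Matrix.single_apply, apply_ite (MatrixReduction.map n f)]

end MatRed

/-! ### Comparison of the localisations -/

section Comparison

/-- A homomorphism out of `B` that inverts `Σ` over `A` factors through the localisation of `B` at
the induced family. -/
lemma UnivLoc.exists_lift_inducedFamily {A B C ι : Type*} [Ring A] [Ring B] [Ring C]
    {S : ι → ProjHom A} {f : A →+* B} (g : B →+* C) (h : IsInverting S (g.comp f)) :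
    ∃ G : UnivLoc (inducedFamily f S) →+* C, ∀ b, G (of (inducedFamily f S) b) = g b := by
  obtain ⟨G, hG, -⟩ := existsUnique_lift g ((isInverting_inducedFamily_iff f g S).2 h)
  exact ⟨G, RingHom.congr_fun hG⟩

lemma UnivLoc.isInverting_of_comp {A B ι : Type*} [Ring A] [Ring B] (S : ι → ProjHom A)
    (f : A →+* B) : IsInverting S ((of (inducedFamily f S)).comp f) :=
  (isInverting_inducedFamily_iff f _ S).1 (isInverting_of _)

variable {k : Type*} [CommRing k] {n : ℕ} {A : Type*} [Ring A] [Algebra k A] {T : Type*} [Ring T]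
  {ι : Type*}

lemma UnivLoc.commute_of_algebraMap (S : ι → ProjHom A) (c : k) (x : UnivLoc S) :
    Commute (of S (algebraMap k A c)) x :=
  commute_of (fun a => Algebra.commutes c a) x

/-- Homomorphisms out of a localisation of `M_n(ⁿ√A)` are determined on the image of `A` and on the
standard matrix units. -/
lemma UnivLoc.matRed_hom_ext {S : ι → ProjHom (MatRed k n A)} {g h : UnivLoc S →+* T}
    (H : ∀ a, g (of S (MatrixReduction.unit k n A a)) = h (of S (MatrixReduction.unit k n A a)))
    (H' : ∀ s t, g (of S (Matrix.single s t 1)) = h (of S (Matrix.single s t 1))) : g = h :=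
  hom_ext (MatRed.ringHom_ext H H')

variable {A' : Type*} [Ring A'] [Algebra k A'] (f : A →ₐ[k] A') (S : ι → ProjHom A)

lemma existsUnique_matFamily_map (n : ℕ) :
    ∃! j : UnivLoc (matFamily k n S) →+* UnivLoc (matFamilyAlong n f S),
      ∀ x : MatRed k n A,
        j (UnivLoc.of (matFamily k n S) x) =
          UnivLoc.of (matFamilyAlong n f S) (MatRed.map n f x) := by
  let g : MatRed k n A →+* UnivLoc (matFamilyAlong n f S) :=
    (UnivLoc.of (matFamilyAlong n f S)).comp (MatRed.map n f).toRingHom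
  have hg : IsInverting S (g.comp (MatrixReduction.unit k n A).toRingHom) := by
    have : g.comp (MatrixReduction.unit k n A).toRingHom =
        (UnivLoc.of (matFamilyAlong n f S)).comp
          ((MatrixReduction.unit k n A').comp f).toRingHom :=
      RingHom.ext fun a => congrArg (UnivLoc.of (matFamilyAlong n f S)) (MatRed.map_unit f a)
    rw [this]
    exact UnivLoc.isInverting_of_comp S _
  obtain ⟨j, hj⟩ := UnivLoc.exists_lift_inducedFamily g hg
  exact ⟨j, hj, fun j' hj' => UnivLoc.hom_ext (RingHom.ext fun x => (hj' x).trans (hj x).symm)⟩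

variable {S}

lemma existsUnique_matFamily_to_univLoc {B : Type*} [Ring B]
    (e : UnivLoc S ≃+* Matrix (Fin n) (Fin n) B) :
    ∃! π : UnivLoc (matFamily k n S) →+* UnivLoc S,
      (∀ a : A, π (UnivLoc.of (matFamily k n S) (MatrixReduction.unit k n A a)) =
        UnivLoc.of S a) ∧
      ∀ s t : Fin n, e (π (UnivLoc.of (matFamily k n S) (Matrix.single s t 1))) =
        Matrix.single s t 1 := by
  obtain ⟨g, hg, hg'⟩ := MatRed.exists_ringHom (UnivLoc.of S)
    (UnivLoc.commute_of_algebraMap (k := k) S)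
    ((isMatrixUnits_single (m := Fin n) (R := B)).map e.symm.toRingHom)
  obtain ⟨π, hπ⟩ := UnivLoc.exists_lift_inducedFamily (S := S)
    (f := (MatrixReduction.unit k n A).toRingHom) g (by
      rw [show g.comp (MatrixReduction.unit k n A).toRingHom = UnivLoc.of S from RingHom.ext hg]
      exact UnivLoc.isInverting_of S)
  refine ⟨π, ⟨fun a => (hπ _).trans (hg a), fun s t => ?_⟩, fun π' hπ' =>
    UnivLoc.matRed_hom_ext (fun a => ?_) fun s t => e.injective ?_⟩
  · rw [hπ, hg']
    exact e.apply_symm_apply _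
  · rw [hπ'.1, hπ, hg]
  · rw [hπ'.2, hπ, hg']
    exact (e.apply_symm_apply _).symm

/-- The map `π` is split by the homomorphism `θ : A_Σ → M_n(ⁿ√A)_{Σ_n}` that `ℓ_{Σ_n} μ_A`
induces. -/
lemma exists_section {π : UnivLoc (matFamily k n S) →+* UnivLoc S}
    (hπ : ∀ a : A, π (UnivLoc.of (matFamily k n S) (MatrixReduction.unit k n A a)) =
      UnivLoc.of S a) :
    ∃ θ : UnivLoc S →+* UnivLoc (matFamily k n S),
      (∀ a, θ (UnivLoc.of S a) =
        UnivLoc.of (matFamily k n S) (MatrixReduction.unit k n A a)) ∧ ∀ x, π (θ x) = x := by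
  obtain ⟨θ, hθ, -⟩ := UnivLoc.existsUnique_lift
    ((UnivLoc.of (matFamily k n S)).comp (MatrixReduction.unit k n A).toRingHom)
    (UnivLoc.isInverting_of_comp S _)
  have hθ' : ∀ a, θ (UnivLoc.of S a) =
      UnivLoc.of (matFamily k n S) (MatrixReduction.unit k n A a) := RingHom.congr_fun hθ
  have h : π.comp θ = RingHom.id _ := UnivLoc.hom_ext (RingHom.ext fun a => by
    simp only [RingHom.comp_apply, RingHom.id_apply, hθ', hπ])
  exact ⟨θ, hθ', RingHom.congr_fun h⟩

variable {f}

/-- The presentation of `A'_{Σ'}` as a quotient of `M_n(ⁿ√A')_{Σ'_n}`. -/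
lemma exists_quotient_equiv
    {j : UnivLoc (matFamily k n S) →+* UnivLoc (matFamilyAlong n f S)}
    {π : UnivLoc (matFamily k n S) →+* UnivLoc S}
    (hj : ∀ x : MatRed k n A, j (UnivLoc.of (matFamily k n S) x) =
      UnivLoc.of (matFamilyAlong n f S) (MatRed.map n f x))
    (hπ : ∀ a : A, π (UnivLoc.of (matFamily k n S) (MatrixReduction.unit k n A a)) =
      UnivLoc.of S a) :
    ∃ Φ : (TwoSidedIdeal.span
            (j '' (TwoSidedIdeal.ker π : Set (UnivLoc (matFamily k n S))))).ringCon.Quotient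
          ≃+* UnivLoc (inducedFamily f.toRingHom S),
      ∀ a' : A',
        Φ (RingCon.mk' _
            (UnivLoc.of (matFamilyAlong n f S) (MatrixReduction.unit k n A' a'))) =
          UnivLoc.of (inducedFamily f.toRingHom S) a' := by
  set S' := inducedFamily f.toRingHom S
  set I' := TwoSidedIdeal.span
    (j '' (TwoSidedIdeal.ker π : Set (UnivLoc (matFamily k n S)))) with hI'
  let q : UnivLoc (matFamilyAlong n f S) →+* I'.ringCon.Quotient := I'.ringCon.mk'
  obtain ⟨θ, hθ, hπθ⟩ := exists_section hπ
  -- the map `A_Σ → A'_{Σ'}` induced by `f`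
  obtain ⟨F, hF, -⟩ := UnivLoc.existsUnique_lift ((UnivLoc.of S').comp f.toRingHom)
    (UnivLoc.isInverting_of_comp S _)
  have hF' : ∀ a, F (UnivLoc.of S a) = UnivLoc.of S' (f a) := RingHom.congr_fun hF
  -- `F ∘ π` carries the matrix units to `A'_{Σ'}`, which gives the map from `M_n(ⁿ√A')`
  obtain ⟨G, hG, hG'⟩ := MatRed.exists_ringHom (UnivLoc.of S')
    (UnivLoc.commute_of_algebraMap (k := k) S')
    ((isMatrixUnits_single (m := Fin n) (R := MatrixReduction k n A)).map
      ((F.comp π).comp (UnivLoc.of (matFamily k n S))))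
  obtain ⟨Φ₀, hΦ₀⟩ := UnivLoc.exists_lift_inducedFamily (S := S)
    (f := ((MatrixReduction.unit k n A').comp f).toRingHom) G (by
      rw [show G.comp ((MatrixReduction.unit k n A').comp f).toRingHom =
        (UnivLoc.of S').comp f.toRingHom from RingHom.ext fun a => hG (f a)]
      exact UnivLoc.isInverting_of_comp S _)
  have hΦj : Φ₀.comp j = F.comp π := by
    refine UnivLoc.matRed_hom_ext (fun a => ?_) fun s t => ?_
    · simp only [RingHom.comp_apply]
      rw [hj, hΦ₀, MatRed.map_unit, hG, hπ, hF']
    · simp only [RingHom.comp_apply]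
      rw [hj, hΦ₀, MatRed.map_single, hG']
      rfl
  have hker : I' ≤ TwoSidedIdeal.ker Φ₀ := by
    rw [hI', TwoSidedIdeal.span_le]
    rintro _ ⟨x, hx, rfl⟩
    have hx' : π x = 0 := (TwoSidedIdeal.mem_ker _).1 hx
    refine (TwoSidedIdeal.mem_ker _).2 ((RingHom.congr_fun hΦj x).trans ?_)
    rw [RingHom.comp_apply, hx', map_zero]
  let Φ : I'.ringCon.Quotient →+* UnivLoc S' :=
    RingCon.lift _ Φ₀ (TwoSidedIdeal.ringCon_le_iff.1 hker)
  have hΦ : ∀ x, Φ (q x) = Φ₀ x := fun _ => rfl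
  -- the inverse is induced by `A' → M_n(ⁿ√A')_{Σ'_n} → M_n(ⁿ√A')_{Σ'_n}/I'`
  obtain ⟨Ψ, hΨ⟩ := UnivLoc.exists_lift_inducedFamily (S := S) (f := f.toRingHom)
    ((q.comp (UnivLoc.of (matFamilyAlong n f S))).comp (MatrixReduction.unit k n A').toRingHom)
    ((UnivLoc.isInverting_of_comp S ((MatrixReduction.unit k n A').comp f).toRingHom).comp q)
  have hΨ' : ∀ a', Ψ (UnivLoc.of S' a') =
      q (UnivLoc.of (matFamilyAlong n f S) (MatrixReduction.unit k n A' a')) := hΨ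
  -- `θ ∘ π` is the identity modulo `ker π`, and `q ∘ j` does not see the difference
  have hqj : ∀ x, q (j (θ (π x))) = q (j x) := fun x => by
    refine (RingCon.eq _).2 ((TwoSidedIdeal.rel_iff _ _ _).2 (TwoSidedIdeal.subset_span
      ⟨θ (π x) - x, (TwoSidedIdeal.mem_ker _).2 ?_, map_sub _ _ _⟩))
    rw [map_sub, hπθ, sub_self]
  have hΨF : Ψ.comp F = (q.comp j).comp θ := UnivLoc.hom_ext (RingHom.ext fun a => by
    simp only [RingHom.comp_apply]
    rw [hF', hΨ', hθ, hj, MatRed.map_unit])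
  have hΦΨ : Φ.comp Ψ = RingHom.id _ := UnivLoc.hom_ext (RingHom.ext fun a' => by
    simp only [RingHom.comp_apply, RingHom.id_apply]
    rw [hΨ', hΦ, hΦ₀, hG])
  have hΨΦ : (Ψ.comp Φ).comp q = q := by
    refine UnivLoc.matRed_hom_ext (fun a' => ?_) fun s t => ?_
    · simp only [RingHom.comp_apply]
      rw [hΦ, hΦ₀, hG, hΨ']
    · simp only [RingHom.comp_apply]
      rw [hΦ, hΦ₀, hG']
      refine (RingHom.congr_fun hΨF _).trans ((hqj _).trans ?_)
      rw [hj, MatRed.map_single]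
  refine ⟨RingEquiv.ofRingHom Φ Ψ hΦΨ (RingHom.ext fun y => ?_), fun a' => ?_⟩
  · obtain ⟨x, rfl⟩ := I'.ringCon.mk'_surjective y
    exact RingHom.congr_fun hΨΦ x
  · exact (hΦ₀ _).trans (hG a')

end Comparison

end

theorem mainTheorem8
    {k : Type*} [CommRing k]
    {A : Type*} [Ring A] [Algebra k A]
    {A' : Type*} [Ring A'] [Algebra k A']
    (f : A →ₐ[k] A')
    {ι : Type*} (S : ι → ProjHom A)
    (n : ℕ) {B : Type*} [Ring B]
    (e : UnivLoc S ≃+* Matrix (Fin n) (Fin n) B) :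
    -- the map `j` of localisations induced by `M_n(ⁿ√f)`
    (∃! j : UnivLoc (matFamily k n S) →+* UnivLoc (matFamilyAlong n f S),
      ∀ x : MatRed k n A,
        j (UnivLoc.of (matFamily k n S) x) =
          UnivLoc.of (matFamilyAlong n f S) (MatRed.map n f x)) ∧
    -- the map `π` from the localisation of `M_n(ⁿ√A)` to `A_Σ ≅ M_n(B)`
    (∃! π : UnivLoc (matFamily k n S) →+* UnivLoc S,
      (∀ a : A, π (UnivLoc.of (matFamily k n S) (MatrixReduction.unit k n A a)) =
        UnivLoc.of S a) ∧
      ∀ s t : Fin n, e (π (UnivLoc.of (matFamily k n S) (Matrix.single s t 1))) =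
        Matrix.single s t 1) ∧
    -- every such `π` presents `A_Σ` as a quotient, and the image under `j` of its kernel
    -- generates the relations that present the localisation of `A'`
    ∀ (j : UnivLoc (matFamily k n S) →+* UnivLoc (matFamilyAlong n f S))
      (π : UnivLoc (matFamily k n S) →+* UnivLoc S),
      (∀ x : MatRed k n A,
        j (UnivLoc.of (matFamily k n S) x) =
          UnivLoc.of (matFamilyAlong n f S) (MatRed.map n f x)) →
      (∀ a : A, π (UnivLoc.of (matFamily k n S) (MatrixReduction.unit k n A a)) =
        UnivLoc.of S a) →
      Function.Surjective π ∧
      ∃ Φ : (TwoSidedIdeal.span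
              (j '' (TwoSidedIdeal.ker π : Set (UnivLoc (matFamily k n S))))).ringCon.Quotient
            ≃+* UnivLoc (inducedFamily f.toRingHom S),
        ∀ a' : A',
          Φ (RingCon.mk' _
              (UnivLoc.of (matFamilyAlong n f S) (MatrixReduction.unit k n A' a'))) =
            UnivLoc.of (inducedFamily f.toRingHom S) a' := by
  refine ⟨existsUnique_matFamily_map f S n, existsUnique_matFamily_to_univLoc e,
    fun j π hj hπ => ⟨?_, exists_quotient_equiv hj hπ⟩⟩
  obtain ⟨θ, -, hθ⟩ := exists_section hπ
  exact fun x => ⟨θ x, hθ x⟩
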